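/- All rings are commutative with unit. For a ring extension $R\subseteq S$ (with the same unit), let $[R,S]$ be the set of $R$-subalgebras of $S$, ordered by inclusion. The extension has FCP if every chain in $[R,S]$ is finite; the length of a finite chain is its number of elements minus one, and $\ell[R,S]$ is the supremum of the lengths of the finite chains in $[R,S]$. An FCP extension $R\subseteq S$ is called catenarian if all maximal chains of $[R,S]$ have the same length. Let $\mathrm{Supp}(S/R)$ be the set of prime ideals $P$ of $R$ such that $(S/R)_P\neq 0$ (where $S/R$ is the quotient $R$-module), and let $\mathrm{MSupp}(S/R)$ be the set of maximal ideals of $R$ in $\mathrm{Supp}(S/R)$. For a prime ideal $P$ of $R$, $R_P\subseteq S_P$ denotes the extension obtained by localizing at $R\setminus P$. Proposition 3.3. Let $R\subseteq S$ be an FCP ring extension. (1) If $R\subseteq S$ is integral, then $R\subseteq S$ is catenarian if and only if $R_M\subseteq S_M$ is catenarian for each $M\in\mathrm{MSupp}(S/R)$. (2) Whether or not $R\subseteq S$ is integral, the following statements are equivalent: (a) $R\subseteq S$ is catenarian; (b) $R_M\subseteq S_M$ is catenarian for each $M\in\mathrm{MSupp}(S/R)$; (c) $R_P\subseteq S_P$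 is catenarian for each $P\in\mathrm{Supp}(S/R)$. (3) If $R\subseteq S$ is integral, then $\mathrm{MSupp}(S/R)$ is finite and $\ell[R,S]=\sum_{M\in\mathrm{MSupp}(S/R)}\ell[R_M,S_M]$. -/

import Mathlib

/-- The ring extension `R ⊆ S` has FCP: each chain in `[R, S]`, the poset of `R`-subalgebras of `S`
ordered by inclusion, is finite. -/
def HasFCP (R S : Type*) [CommRing R] [CommRing S] [Algebra R S] : Prop :=
  ∀ c : Set (Subalgebra R S), IsChain (· ≤ ·) c → c.Finite

/-- The extension `R ⊆ S` is catenarian: it has FCP and all maximal chains of `[R, S]` have the same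
length. A `Flag` is a maximal chain (it automatically contains `R` and `S`). The length of a finite
chain is its number of elements minus one, so that equal lengths mean equal numbers of elements. -/
def IsCatenarian (R S : Type*) [CommRing R] [CommRing S] [Algebra R S] : Prop :=
  HasFCP R S ∧
    ∀ c d : Flag (Subalgebra R S),
      (c : Set (Subalgebra R S)).encard = (d : Set (Subalgebra R S)).encard

/-- `ℓ[R, S]`, the supremum in `ℕ∞` of the lengths `n` of the chains `T₀ ⊂ T₁ ⊂ ⋯ ⊂ Tₙ` of
`R`-subalgebras of `S`. -/
noncomputable def extLength (R S : Type*) [CommRing R] [CommRing S] [Algebra R S] : ℕ∞ :=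
  ⨆ p : LTSeries (Subalgebra R S), (p.length : ℕ∞)

/-- `Supp(S/R)`, the support of the `R`-module `S/R`. -/
def extSupp (R S : Type*) [CommRing R] [CommRing S] [Algebra R S] : Set (PrimeSpectrum R) :=
  Module.support R (S ⧸ LinearMap.range (Algebra.linearMap R S))

/-- `MSupp(S/R) = Supp(S/R) ∩ Max(R)`. -/
def extMSupp (R S : Type*) [CommRing R] [CommRing S] [Algebra R S] : Set (PrimeSpectrum R) :=
  {P | P ∈ extSupp R S ∧ P.asIdeal.IsMaximal}

/-- `R_P`. -/
abbrev BaseLoc (R : Type*) [CommRing R] (P : PrimeSpectrum R) : Type _ :=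
  Localization P.asIdeal.primeCompl

/-- `S_P`, the localization of the ring `S` at the image of `R ∖ P`; it is an `R_P`-algebra through
the localization of `R → S` (Mathlib's instance `localizationAlgebra`). -/
abbrev ExtLoc (R S : Type*) [CommRing R] [CommRing S] [Algebra R S] (P : PrimeSpectrum R) : Type _ :=
  Localization (Algebra.algebraMapSubmonoid S P.asIdeal.primeCompl)

/-!
# Catenarian FCP extensions and localization

Everything takes place in the poset `[R, S]` of the subalgebras of `S`; localization enters through
the *saturation* `T.saturationAt P = {s | a s ∈ T for some a ∉ P}`, the preimage of `T_P` in `S`.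

A minimal step `T ⋖ U` of `[R, S]` has a crucial maximal ideal `𝔪`, the only prime of `T` in the
support of `U / T` (`exists_crucial_of_bot_covBy`). The main point is `exists_smul_mem_bot_of_mem`:
if the elements outside a prime `𝔫` act injectively on `U / T`, no element of `𝔫` does. With
`P = 𝔪 ∩ R`, the crucial prime of the step, saturation at a prime `Q` maps `T ⋖ U` to a covering
pair if `P ≤ Q` and to an equality otherwise (`IsCrucialPrime`). If `T ⋖ U` and `T` is saturated
at `Q`, then so is `U` (`saturationAt_eq_of_covBy`). By the chain conditions every subalgebra above
the saturation `R^Q` of `R` at `Q` is therefore saturated, and `[R_Q, S_Q]` is isomorphic to the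
interval `[R^Q, S]` of `[R, S]` (`exists_orderIso_Ici`).

*Catenarity.* The equality of lengths of saturated chains passes from `[R, S]` to the upper interval
`[R^P, S]`, and from `[R^M, S]` to `[R^P, S]` when `P ≤ M`, because a common initial chain can be
prepended. Conversely, a saturated chain from `R` to `S` has a multiset of crucial primes `P`, and
its image in `[R^Q, S]` is a saturated chain whose length is the number of those with `P ≤ Q`. If
all `R_Q ⊆ S_Q` are catenarian, these numbers do not depend on the chain, and they determine the
multiset (`Multiset.eq_of_countP_le_eq`), whose cardinality is the length of the chain.

*Lengths.* If `S` is integral over `R`, crucial primes are maximal. The primes of a saturated chain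
are then exactly the members of `MSupp(S/R)`, each counted at most `ℓ[R_M, S_M]` times, which bounds
`ℓ[R, S]` from above. For the other inequality, distinct maximal ideals `M`, `N` satisfy
`(R^N)^M = S` (`saturationAt_saturationAt_eq_top`), which allows chains of the various `[R^M, S]` to
be stacked inside `[R, S]` (`sum_chainLength_le`).
-/

/-! ### Chains in ordered sets -/

/-- `StepChain r x y n`: there are `x = x₀, x₁, …, xₙ = y` with `r xᵢ xᵢ₊₁` for all `i < n`. It is
used for `r = (· ⋖ ·)` (saturated chains) and for `r = (· < ·)` (strict chains). -/
inductive StepChain {α : Type*} (r : α → α → Prop) : α → α → ℕ → Prop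
  | refl (x : α) : StepChain r x x 0
  | snoc {x y z : α} {n : ℕ} : StepChain r x y n → r y z → StepChain r x z (n + 1)

namespace StepChain

variable {α β : Type*}

theorem single {r : α → α → Prop} {x y : α} (h : r x y) : StepChain r x y 1 := (refl x).snoc h

theorem trans {r : α → α → Prop} {x y z : α} {m n : ℕ} (h : StepChain r x y m)
    (h' : StepChain r y z n) : StepChain r x z (m + n) := by
  induction h' with
  | refl => exact h
  | snoc _ h₂ ih => exact ih.snoc h₂

theorem map {r : α → α → Prop} {s : β → β → Prop} (f : α → β)
    (hf : ∀ a b, r a b → s (f a) (f b)) {x y : α} {n : ℕ} (h : StepChain r x y n) :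
    StepChain s (f x) (f y) n := by
  induction h with
  | refl => exact refl _
  | snoc _ h₂ ih => exact ih.snoc (hf _ _ h₂)

variable [PartialOrder α]

theorem le {x y : α} {n : ℕ} (h : StepChain (· < ·) x y n) : x ≤ y := by
  induction h with
  | refl => exact le_rfl
  | snoc _ h₂ ih => exact ih.trans (le_of_lt h₂)

theorem lt_of_pos {x y : α} {n : ℕ} (h : StepChain (· < ·) x y n) (hn : n ≠ 0) : x < y := by
  cases h with
  | refl => exact absurd rfl hn
  | snoc h₁ h₂ => exact h₁.le.trans_lt h₂

theorem strict {x y : α} {n : ℕ} (h : StepChain (· ⋖ ·) x y n) : StepChain (· < ·) x y n :=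
  h.map id fun _ _ hab => hab.lt

theorem eq_zero_of_self {x : α} {n : ℕ} (h : StepChain (· < ·) x x n) : n = 0 := by
  by_contra hn
  exact lt_irrefl x (h.lt_of_pos hn)

end StepChain

theorem wellFoundedLT_of_finite_chains {α : Type*} [PartialOrder α]
    (h : ∀ c : Set α, IsChain (· ≤ ·) c → c.Finite) : WellFoundedLT α := by
  refine ⟨RelEmbedding.wellFounded_iff_isEmpty.2 ⟨fun f => ?_⟩⟩
  have hf : StrictAnti f := fun a b hab => f.map_rel_iff.2 hab
  refine Set.infinite_range_of_injective hf.injective (h _ ?_)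
  rintro _ ⟨a, rfl⟩ _ ⟨b, rfl⟩ -
  exact (le_total a b).symm.imp (fun h => hf.antitone h) (fun h => hf.antitone h)

theorem wellFoundedGT_of_finite_chains {α : Type*} [PartialOrder α]
    (h : ∀ c : Set α, IsChain (· ≤ ·) c → c.Finite) : WellFoundedGT α := by
  have := wellFoundedLT_of_finite_chains (α := αᵒᵈ) fun c hc => h c hc.symm
  exact ⟨this.wf⟩

theorem exists_covBy_stepChain {α : Type*} [PartialOrder α] [WellFoundedLT α] [WellFoundedGT α]
    {a b : α} (hab : a ≤ b) : ∃ n, StepChain (· ⋖ ·) a b n := by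
  induction a using WellFoundedGT.induction with
  | ind a ih =>
    rcases hab.eq_or_lt with rfl | hlt
    · exact ⟨0, .refl _⟩
    · obtain ⟨x, hax, hxb⟩ := exists_covBy_le_of_lt hlt
      obtain ⟨n, hn⟩ := ih x hax.lt hxb
      exact ⟨_, (StepChain.single hax).trans hn⟩

/-- A strict chain can be refined to a saturated chain with the same ends. -/
theorem StepChain.exists_refinement {α : Type*} [PartialOrder α] [WellFoundedLT α]
    [WellFoundedGT α] {a b : α} {n : ℕ} (h : StepChain (· < ·) a b n) :
    ∃ m, n ≤ m ∧ StepChain (· ⋖ ·) a b m := by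
  induction h with
  | refl => exact ⟨0, le_rfl, .refl _⟩
  | snoc _ h₂ ih =>
    obtain ⟨m, hm, hc⟩ := ih
    obtain ⟨k, hk⟩ := exists_covBy_stepChain (le_of_lt h₂)
    have hk0 : k ≠ 0 := by
      rintro rfl
      cases hk
      exact lt_irrefl _ h₂
    exact ⟨m + k, by omega, hc.trans hk⟩

/-- The members of a saturated chain form a set which is maximal among the chains between its
ends. -/
theorem StepChain.exists_set {α : Type*} [PartialOrder α] {a b : α} {n : ℕ}
    (h : StepChain (· ⋖ ·) a b n) :
    ∃ c : Set α, IsChain (· ≤ ·) c ∧ a ∈ c ∧ b ∈ c ∧ c ⊆ Set.Icc a b ∧ c.encard = n + 1 ∧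
      ∀ z ∈ Set.Icc a b, (∀ w ∈ c, z ≤ w ∨ w ≤ z) → z ∈ c := by
  induction h with
  | refl =>
    refine ⟨{a}, Set.subsingleton_singleton.isChain, rfl, rfl, by simp, by simp, ?_⟩
    rintro z ⟨h1, h2⟩ -
    exact le_antisymm h2 h1
  | @snoc y z n h₁ h₂ ih =>
    obtain ⟨c, hc, hx, hy, hsub, hcard, hmax⟩ := ih
    have hlt : y < z := h₂.lt
    have hz : z ∉ c := fun hz => absurd (hsub hz).2 (not_le_of_gt hlt)
    have hxy := (hsub hx).2
    refine ⟨insert z c, hc.insert fun w hw _ => Or.inr ((hsub hw).2.trans hlt.le),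
      Set.mem_insert_of_mem _ hx, Set.mem_insert _ _, ?_, ?_, ?_⟩
    · rintro w (rfl | hw)
      · exact ⟨hxy.trans hlt.le, le_rfl⟩
      · exact ⟨(hsub hw).1, (hsub hw).2.trans hlt.le⟩
    · rw [Set.encard_insert_of_notMem hz, hcard]
      push_cast
      rfl
    · rintro w ⟨hw1, hw2⟩ hcomp
      rcases hcomp y (Set.mem_insert_of_mem _ hy) with h | h
      · exact Set.mem_insert_of_mem _
          (hmax w ⟨hw1, h⟩ fun v hv => hcomp v (Set.mem_insert_of_mem _ hv))
      · rcases h.eq_or_lt with rfl | h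
        · exact Set.mem_insert_of_mem _ hy
        · rcases hw2.eq_or_lt with rfl | h'
          · exact Set.mem_insert _ _
          · exact absurd h' (h₂.2 h)

theorem StepChain.exists_flag {α : Type*} [PartialOrder α] [BoundedOrder α] {n : ℕ}
    (h : StepChain (· ⋖ ·) (⊥ : α) ⊤ n) : ∃ c : Flag α, (c : Set α).encard = n + 1 := by
  obtain ⟨c, hc, -, -, -, hcard, hmax⟩ := h.exists_set
  refine ⟨⟨c, hc, fun s hs hcs => hcs.antisymm fun z hz => ?_⟩, hcard⟩
  exact hmax z ⟨bot_le, le_top⟩ fun w hw => hs.total hz (hcs hw)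

theorem Flag.exists_stepChain {α : Type*} [PartialOrder α] [BoundedOrder α] (c : Flag α)
    (hfin : (c : Set α).Finite) :
    ∃ n : ℕ, StepChain (· ⋖ ·) (⊥ : α) ⊤ n ∧ (c : Set α).encard = n + 1 := by
  have key : ∀ n : ℕ, ∀ y ∈ c, {z : α | z ∈ c ∧ z < y}.ncard = n →
      StepChain (· ⋖ ·) ⊥ y n := by
    intro n
    induction n with
    | zero =>
      intro y hy h0
      have hf : {z : α | z ∈ c ∧ z < y}.Finite := hfin.subset fun z hz => hz.1
      rw [Set.ncard_eq_zero hf] at h0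
      have : y = ⊥ := by
        by_contra hne
        have : (⊥ : α) ∈ {z : α | z ∈ c ∧ z < y} := ⟨c.bot_mem, bot_lt_iff_ne_bot.2 hne⟩
        rw [h0] at this
        exact this
      subst this
      exact .refl _
    | succ n ih =>
      intro y hy hn
      have hf : {z : α | z ∈ c ∧ z < y}.Finite := hfin.subset fun z hz => hz.1
      have hne : {z : α | z ∈ c ∧ z < y}.Nonempty := by
        rw [← Set.ncard_pos hf, hn]
        omega
      obtain ⟨x, hx⟩ := hf.exists_maximal hne
      have hxmax : ∀ z ∈ c, z < y → z ≤ x := fun z hz hzy =>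
        (c.le_or_le hz hx.1.1).elim id fun h => hx.2 ⟨hz, hzy⟩ h
      have hcov : x ⋖ y := by
        refine ⟨hx.1.2, fun w hxw hwy => ?_⟩
        have hw : w ∈ c := by
          have hins : IsChain (· ≤ ·) (insert w (c : Set α)) := by
            refine c.chain_le.insert fun v hv _ => ?_
            rcases c.le_or_le hv hy with h | h
            · rcases h.eq_or_lt with rfl | h
              · exact Or.inl hwy.le
              · exact Or.inr ((hxmax v hv h).trans hxw.le)
            · exact Or.inl (hwy.le.trans h)
          have := c.max_chain' hins (Set.subset_insert _ _)
          change w ∈ c.carrier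
          rw [this]
          exact Set.mem_insert _ _
        exact absurd (hxmax w hw hwy) (not_le_of_gt hxw)
      refine (ih x hx.1.1 ?_).snoc hcov
      have heq : {z : α | z ∈ c ∧ z < y} = insert x {z : α | z ∈ c ∧ z < x} := by
        ext z
        simp only [Set.mem_ofPred_eq, Set.mem_insert_iff]
        constructor
        · rintro ⟨hz, hzy⟩
          exact (hxmax z hz hzy).eq_or_lt.imp id fun h => ⟨hz, h⟩
        · rintro (rfl | ⟨hz, hzx⟩)
          · exact hx.1
          · exact ⟨hz, hzx.trans hx.1.2⟩
      rw [heq, Set.ncard_insert_of_notMem (by simp) (hfin.subset fun z hz => hz.1)] at hn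
      omega
  refine ⟨_, key _ ⊤ c.top_mem rfl, ?_⟩
  have hf : {z : α | z ∈ c ∧ z < ⊤}.Finite := hfin.subset fun z hz => hz.1
  rw [hf.cast_ncard_eq, ← Set.encard_insert_of_notMem (a := ⊤) (by simp)]
  congr 1
  ext z
  simp only [Set.mem_insert_iff, Set.mem_ofPred_eq, SetLike.mem_coe]
  constructor
  · intro hz
    exact (le_top (a := z)).eq_or_lt.imp id fun h => ⟨hz, h⟩
  · rintro (rfl | hz)
    · exact c.top_mem
    · exact hz.1

/-- The Jordan–Dedekind condition between two elements: all saturated chains from `a` to `b` have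
the same length. -/
def ChainsEqui {α : Type*} [PartialOrder α] (a b : α) : Prop :=
  ∀ m n : ℕ, StepChain (· ⋖ ·) a b m → StepChain (· ⋖ ·) a b n → m = n

theorem ChainsEqui.self {α : Type*} [PartialOrder α] (a : α) : ChainsEqui a a :=
  fun _ _ hm hn => hm.strict.eq_zero_of_self.trans hn.strict.eq_zero_of_self.symm

theorem ChainsEqui.of_le {α : Type*} [PartialOrder α] [WellFoundedLT α] [WellFoundedGT α]
    {a b c : α} (h : ChainsEqui a c) (hab : a ≤ b) : ChainsEqui b c := by
  intro m n hm hn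
  obtain ⟨k, hk⟩ := exists_covBy_stepChain hab
  have := h _ _ (hk.trans hm) (hk.trans hn)
  omega

theorem isCatenarian_iff {R S : Type*} [CommRing R] [CommRing S] [Algebra R S] :
    IsCatenarian R S ↔ HasFCP R S ∧ ChainsEqui (⊥ : Subalgebra R S) ⊤ := by
  refine and_congr_right fun hF => ⟨fun h m n hm hn => ?_, fun h c d => ?_⟩
  · obtain ⟨c, hc⟩ := hm.exists_flag
    obtain ⟨d, hd⟩ := hn.exists_flag
    have := h c d
    rw [hc, hd] at this
    have : m + 1 = n + 1 := by exact_mod_cast this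
    omega
  · obtain ⟨m, hm, hc⟩ := c.exists_stepChain (hF _ c.chain_le)
    obtain ⟨n, hn, hd⟩ := d.exists_stepChain (hF _ d.chain_le)
    rw [hc, hd, h m n hm hn]

theorem LTSeries.stepChain {α : Type*} [PartialOrder α] (p : LTSeries α) :
    StepChain (· < ·) p.head p.last p.length := by
  have key : ∀ i : ℕ, ∀ hi : i < p.length + 1, StepChain (· < ·) p.head (p ⟨i, hi⟩) i := by
    intro i
    induction i with
    | zero => exact fun _ => .refl _
    | succ i ih => exact fun hi => (ih (by omega)).snoc (p.step ⟨i, by omega⟩)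
  exact key p.length (by omega)

theorem StepChain.exists_ltSeries {α : Type*} [PartialOrder α] {a b : α} {n : ℕ}
    (h : StepChain (· < ·) a b n) : ∃ p : LTSeries α, p.last = b ∧ p.length = n := by
  induction h with
  | refl => exact ⟨RelSeries.singleton _ a, rfl, rfl⟩
  | snoc _ h₂ ih =>
    obtain ⟨p, hp, hl⟩ := ih
    exact ⟨p.snoc _ (by rw [hp]; exact h₂), by simp, by simp [hl]⟩

/-- The supremum of the lengths of the strict chains from `a` to `b`. -/
noncomputable def chainLength {α : Type*} [PartialOrder α] (a b : α) : ℕ∞ :=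
  ⨆ n : {n : ℕ // StepChain (· < ·) a b n}, (n.1 : ℕ∞)

theorem StepChain.le_chainLength {α : Type*} [PartialOrder α] {a b : α} {n : ℕ}
    (h : StepChain (· < ·) a b n) : (n : ℕ∞) ≤ chainLength a b :=
  le_iSup (fun n : {n : ℕ // StepChain (· < ·) a b n} => (n.1 : ℕ∞)) ⟨n, h⟩

theorem StepChain.exists_extension {α : Type*} [PartialOrder α] [BoundedOrder α] {a b : α} {n : ℕ}
    (h : StepChain (· < ·) a b n) : ∃ m, n ≤ m ∧ StepChain (· < ·) (⊥ : α) ⊤ m := by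
  have h1 : ∃ m, n ≤ m ∧ StepChain (· < ·) (⊥ : α) b m := by
    rcases (bot_le (a := a)).eq_or_lt with rfl | hlt
    · exact ⟨n, le_rfl, h⟩
    · exact ⟨1 + n, by omega, (StepChain.single hlt).trans h⟩
  obtain ⟨m, hm, hc⟩ := h1
  rcases (le_top (a := b)).eq_or_lt with rfl | hlt
  · exact ⟨m, hm, hc⟩
  · exact ⟨m + 1, by omega, hc.snoc hlt⟩

theorem extLength_eq_chainLength (R S : Type*) [CommRing R] [CommRing S] [Algebra R S] :
    extLength R S = chainLength (⊥ : Subalgebra R S) ⊤ := by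
  refine le_antisymm (iSup_le fun p => ?_) (iSup_le fun n => ?_)
  · obtain ⟨m, hm, hc⟩ := p.stepChain.exists_extension
    exact le_trans (by exact_mod_cast hm) hc.le_chainLength
  · obtain ⟨p, -, hp⟩ := n.2.exists_ltSeries
    rw [← hp]
    exact le_iSup (fun p : LTSeries (Subalgebra R S) => (p.length : ℕ∞)) p

theorem StepChain.subtype_Ici {α : Type*} [PartialOrder α] {a b : α} {r : α → α → Prop}
    {s : Set.Ici a → Set.Ici a → Prop} (hr : ∀ x y, r x y → x ≤ y)
    (hs : ∀ x y : Set.Ici a, r x y → s x y) {n : ℕ} (h : StepChain r a b n) :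
    ∃ hb : a ≤ b, StepChain s ⟨a, le_rfl⟩ ⟨b, hb⟩ n := by
  induction h with
  | refl => exact ⟨le_rfl, .refl _⟩
  | snoc _ h₂ ih =>
    obtain ⟨hb, hc⟩ := ih
    exact ⟨hb.trans (hr _ _ h₂), hc.snoc (hs _ _ h₂)⟩

theorem stepChain_iff_of_orderIso_Ici {α β : Type*} [PartialOrder α] [OrderTop α] [PartialOrder β]
    [BoundedOrder β] {a : α} (e : β ≃o Set.Ici a) {r : α → α → Prop} {s : β → β → Prop}
    (hr : ∀ x y, r x y → x ≤ y) (hs : ∀ x y : β, s x y ↔ r (e x) (e y)) {n : ℕ} :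
    StepChain s ⊥ ⊤ n ↔ StepChain r a ⊤ n := by
  have hbot : e ⊥ = ⟨a, le_rfl⟩ := le_antisymm
    (by rw [← e.le_symm_apply]; exact bot_le) (e ⊥).2
  have htop : e ⊤ = ⟨⊤, le_top⟩ := le_antisymm (Subtype.mk_le_mk.2 le_top)
    (by rw [← e.symm_apply_le]; exact le_top)
  constructor
  · intro h
    have := h.map (s := r) (fun x => (e x : α)) fun x y => (hs x y).1
    simpa only [hbot, htop] using this
  · intro h
    obtain ⟨_, h'⟩ := h.subtype_Ici (s := fun x y => r x y) hr fun _ _ => id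
    have := h'.map (s := s) e.symm fun x y hxy => (hs _ _).2 (by simpa using hxy)
    rwa [← hbot, ← htop, e.symm_apply_apply, e.symm_apply_apply] at this

/-- In a partial order a finite multiset is determined by the number of its members below each
element. -/
theorem Multiset.eq_of_countP_le_eq {α : Type*} [PartialOrder α] [DecidableEq α]
    [DecidableLE α] (n : ℕ) : ∀ A B : Multiset α, A.card = n →
    (∀ x, A.countP (· ≤ x) = B.countP (· ≤ x)) → A = B := by
  induction n with
  | zero =>
    intro A B hA h
    rw [Multiset.card_eq_zero] at hA
    subst hA
    refine (Multiset.eq_zero_of_forall_notMem fun x hx => ?_).symm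
    have := h x
    rw [Multiset.countP_zero, eq_comm, Multiset.countP_eq_zero] at this
    exact this x hx le_rfl
  | succ n ih =>
    intro A B hA h
    have hne : (A + B).toFinset.Nonempty := by
      obtain ⟨a, ha⟩ := Multiset.card_pos_iff_exists_mem.1 (show 0 < A.card by omega)
      exact ⟨a, by simp [ha]⟩
    obtain ⟨x, hx⟩ := (A + B).toFinset.exists_minimal hne
    have hmin : ∀ y, y ∈ A ∨ y ∈ B → y ≤ x → y = x := fun y hy hyx =>
      le_antisymm hyx (hx.2 (by simpa using hy) hyx)
    have hmem : x ∈ A ↔ x ∈ B := by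
      have hA' : x ∈ A ↔ 0 < A.countP (· ≤ x) := by
        rw [Multiset.countP_pos]
        exact ⟨fun h => ⟨x, h, le_rfl⟩, fun ⟨y, hy, hyx⟩ => hmin y (Or.inl hy) hyx ▸ hy⟩
      have hB' : x ∈ B ↔ 0 < B.countP (· ≤ x) := by
        rw [Multiset.countP_pos]
        exact ⟨fun h => ⟨x, h, le_rfl⟩, fun ⟨y, hy, hyx⟩ => hmin y (Or.inr hy) hyx ▸ hy⟩
      rw [hA', hB', h x]
    have hxA : x ∈ A := by
      have : x ∈ A ∨ x ∈ B := by simpa using hx.1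
      exact this.elim id hmem.2
    obtain ⟨A', rfl⟩ := Multiset.exists_cons_of_mem hxA
    obtain ⟨B', rfl⟩ := Multiset.exists_cons_of_mem (hmem.1 hxA)
    rw [ih A' B' (by simpa using hA)]
    intro y
    have := h y
    rw [Multiset.countP_cons, Multiset.countP_cons] at this
    omega

theorem chainLength_add_le {α : Type*} [PartialOrder α] {a b c : α} (hab : a ≤ b) (hbc : b ≤ c) :
    chainLength a b + chainLength b c ≤ chainLength a c := by
  have hne : ∀ {x y : α}, x ≤ y → Nonempty {n : ℕ // StepChain (· < ·) x y n} := by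
    intro x y h
    rcases h.eq_or_lt with rfl | h
    · exact ⟨0, .refl _⟩
    · exact ⟨1, .single h⟩
  have := hne hab
  have := hne hbc
  refine ENat.iSup_add_iSup_le fun i j => ?_
  exact_mod_cast (i.2.trans j.2).le_chainLength

theorem chainLength_le_of_strictMono {α β : Type*} [PartialOrder α] [PartialOrder β] {a b : α}
    (f : Set.Ici a → β) (hf : StrictMono f) (hab : a ≤ b) :
    chainLength a b ≤ chainLength (f ⟨a, le_rfl⟩) (f ⟨b, hab⟩) := by
  refine iSup_le fun n => ?_
  obtain ⟨_, h⟩ := n.2.subtype_Ici (s := (· < ·)) (fun _ _ h => h.le) fun _ _ h => h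
  exact (h.map (s := (· < ·)) f fun _ _ h => hf h).le_chainLength

/-! ### Saturations of subalgebras -/

section Saturation

variable {R S : Type*} [CommRing R] [CommRing S] [Algebra R S]

/-- The saturation `{s | a • s ∈ T for some a ∉ P}` of a subalgebra `T ⊆ S` at a prime `P` of the
base ring: the preimage in `S` of the localization `T_P ⊆ S_P`. -/
def Subalgebra.saturationAt (P : PrimeSpectrum R) (T : Subalgebra R S) : Subalgebra R S where
  carrier := {s | ∃ a ∉ P.asIdeal, a • s ∈ T}
  mul_mem' := by
    rintro x y ⟨a, ha, hx⟩ ⟨b, hb, hy⟩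
    refine ⟨a * b, P.asIdeal.primeCompl.mul_mem ha hb, ?_⟩
    rw [← smul_mul_smul_comm]
    exact T.mul_mem hx hy
  add_mem' := by
    rintro x y ⟨a, ha, hx⟩ ⟨b, hb, hy⟩
    refine ⟨a * b, P.asIdeal.primeCompl.mul_mem ha hb, ?_⟩
    rw [smul_add, mul_comm a b, mul_smul, mul_comm b a, mul_smul]
    exact T.add_mem (T.smul_mem hx b) (T.smul_mem hy a)
  algebraMap_mem' r := ⟨1, P.asIdeal.primeCompl.one_mem, T.smul_mem (T.algebraMap_mem r) 1⟩

namespace Subalgebra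

theorem le_saturationAt (P : PrimeSpectrum R) (T : Subalgebra R S) : T ≤ T.saturationAt P :=
  fun _ hs => ⟨1, P.asIdeal.primeCompl.one_mem, T.smul_mem hs 1⟩

theorem saturationAt_mono (P : PrimeSpectrum R) {T U : Subalgebra R S} (h : T ≤ U) :
    T.saturationAt P ≤ U.saturationAt P := fun _ ⟨a, ha, hs⟩ => ⟨a, ha, h hs⟩

theorem saturationAt_saturationAt (P : PrimeSpectrum R) (T : Subalgebra R S) :
    (T.saturationAt P).saturationAt P = T.saturationAt P := by
  refine le_antisymm ?_ (le_saturationAt _ _)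
  rintro s ⟨a, ha, b, hb, hs⟩
  exact ⟨b * a, P.asIdeal.primeCompl.mul_mem hb ha, by rwa [mul_smul]⟩

theorem saturationAt_top (P : PrimeSpectrum R) : (⊤ : Subalgebra R S).saturationAt P = ⊤ :=
  top_le_iff.1 (le_saturationAt _ _)

theorem saturationAt_inf (P : PrimeSpectrum R) (T U : Subalgebra R S) :
    (T ⊓ U).saturationAt P = T.saturationAt P ⊓ U.saturationAt P := by
  refine le_antisymm
    (le_inf (saturationAt_mono P inf_le_left) (saturationAt_mono P inf_le_right)) ?_
  rintro s ⟨⟨a, ha, hs⟩, b, hb, hs'⟩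
  refine ⟨a * b, P.asIdeal.primeCompl.mul_mem ha hb, ?_, ?_⟩
  · rw [mul_comm, mul_smul]
    exact T.smul_mem hs b
  · rw [mul_smul]
    exact U.smul_mem hs' a

theorem saturationAt_anti {P Q : PrimeSpectrum R} (h : P ≤ Q) (T : Subalgebra R S) :
    T.saturationAt Q ≤ T.saturationAt P := fun _ ⟨a, ha, hs⟩ => ⟨a, fun hP => ha (h hP), hs⟩

end Subalgebra

end Saturation

/-! ### The crucial maximal ideal of a minimal extension -/

section Minimal

open Polynomial

variable {T S : Type*} [CommRing T] [CommRing S] [Algebra T S]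

theorem aeval_mem_of_mem {U : Subalgebra T S} {x : S} (hx : x ∈ U) (p : T[X]) :
    aeval x p ∈ U :=
  Algebra.adjoin_le (S := U) (by simpa using hx) (aeval_mem_adjoin_singleton T x)

theorem adjoin_eq_of_bot_covBy {U : Subalgebra T S} (h : ⊥ ⋖ U) {x : S} (hx : x ∈ U)
    (hx' : x ∉ (⊥ : Subalgebra T S)) : Algebra.adjoin T {x} = U := by
  have hle : Algebra.adjoin T {x} ≤ U := Algebra.adjoin_le (by simpa using hx)
  by_contra hne
  refine h.2 (bot_lt_iff_ne_bot.2 fun hbot => hx' ?_) (lt_of_le_of_ne hle hne)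
  rw [← hbot]
  exact Algebra.self_mem_adjoin_singleton T x

theorem exists_aeval_eq_of_bot_covBy {U : Subalgebra T S} (h : ⊥ ⋖ U) {x y : S} (hx : x ∈ U)
    (hx' : x ∉ (⊥ : Subalgebra T S)) (hy : y ∈ U) : ∃ p : T[X], aeval x p = y := by
  rw [← adjoin_eq_of_bot_covBy h hx hx', Algebra.adjoin_singleton_eq_range_aeval] at hy
  exact hy

/-- If `y` is a root of a polynomial whose coefficients all lie in the prime `𝔫`, except for that
of `X` (which does not) and possibly the constant one, then some `s ∉ 𝔫` satisfies `s • y ∈ T`.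
The degree is lowered by absorbing the leading term `a yⁿ⁺¹` into the next one: `a y` is
integral over `T`, hence in `T`, hence in `𝔫`. -/
theorem exists_smul_mem_bot_of_root (𝔫 : Ideal T) {y : S}
    (hint : ∀ a : T, IsIntegral T (a • y) → a • y ∈ (⊥ : Subalgebra T S))
    (hn : ∀ a ∈ 𝔫, ∀ c : T, a • y = algebraMap T S c → c ∈ 𝔫) (n : ℕ) :
    ∀ f : T[X], f.natDegree ≤ n → aeval y f = 0 → f.coeff 1 ∉ 𝔫 →
      (∀ i, 2 ≤ i → f.coeff i ∈ 𝔫) → ∃ s ∉ 𝔫, s • y ∈ (⊥ : Subalgebra T S) := by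
  induction n with
  | zero =>
    intro f hf _ h1 _
    exact absurd (by rw [coeff_eq_zero_of_natDegree_lt (by omega)]; exact 𝔫.zero_mem) h1
  | succ n ih =>
    intro f hf h0 h1 h2
    rcases Nat.eq_zero_or_pos n with rfl | hn0
    · refine ⟨_, h1, ?_⟩
      rw [aeval_eq_sum_range' (n := 2) (by omega)] at h0
      simp only [Finset.sum_range_succ, Finset.sum_range_zero, pow_zero, pow_one, zero_add] at h0
      rw [eq_neg_of_add_eq_zero_right h0]
      exact neg_mem (Subalgebra.smul_mem _ (one_mem _) _)
    rcases hf.lt_or_eq with hlt | heq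
    · exact ih f (by omega) h0 h1 h2
    set a := f.coeff (n + 1) with ha
    have han : a ∈ 𝔫 := h2 _ (by omega)
    have hai : IsIntegral T (a • y) := by
      have := isIntegral_leadingCoeff_smul f y h0
      rwa [leadingCoeff, heq] at this
    obtain ⟨c, hc⟩ := Algebra.mem_bot.1 (hint a hai)
    have hcn : c ∈ 𝔫 := hn a han c hc.symm
    have hco : ∀ i, (f - C a * X ^ (n + 1) + C c * X ^ n).coeff i =
        f.coeff i - (if i = n + 1 then a else 0) + (if i = n then c else 0) := by
      intro i
      simp [coeff_X_pow]
    refine ih (f - C a * X ^ (n + 1) + C c * X ^ n) ?_ ?_ ?_ ?_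
    · rw [natDegree_le_iff_coeff_eq_zero]
      intro i hi
      rw [hco]
      rcases eq_or_ne i (n + 1) with rfl | hne
      · simp [ha]
      · rw [coeff_eq_zero_of_natDegree_lt (by omega)]
        simp [hne, (show i ≠ n by omega)]
    · simp only [map_add, map_sub, map_mul, map_pow, aeval_C, aeval_X, h0, hc, Algebra.smul_def]
      ring
    · rw [hco]
      intro hmem
      apply h1
      rw [if_neg (by omega)] at hmem
      split_ifs at hmem
      · simpa using 𝔫.sub_mem hmem hcn
      · simpa using hmem
    · intro i hi
      rw [hco]
      refine 𝔫.add_mem (𝔫.sub_mem (h2 i hi) ?_) ?_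
      · split_ifs
        exacts [han, 𝔫.zero_mem]
      · split_ifs
        exacts [hcn, 𝔫.zero_mem]

/-- In a minimal extension `T ⊂ U`, if the elements outside the prime `𝔫` act injectively on `U/T`,
then no element of `𝔫` does. If `t ∈ 𝔫` acted injectively, then `T` would be integrally closed in
`U` by Nakayama's lemma, and `𝔫U ∩ T = 𝔫`; since `U = T[y²]` for `y ∈ tU ∖ T`, the element `y` would
be a root of a polynomial to which `exists_smul_mem_bot_of_root` applies. -/
theorem exists_smul_mem_bot_of_mem {U : Subalgebra T S} (hTS : Function.Injective (algebraMap T S))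
    (h : ⊥ ⋖ U) (𝔫 : Ideal T) [𝔫.IsPrime]
    (hout : ∀ u ∈ U, ∀ a ∉ 𝔫, a • u ∈ (⊥ : Subalgebra T S) → u ∈ (⊥ : Subalgebra T S))
    {t : T} (ht : t ∈ 𝔫) :
    ∃ u ∈ U, u ∉ (⊥ : Subalgebra T S) ∧ t • u ∈ (⊥ : Subalgebra T S) := by
  by_contra! hinj
  obtain ⟨u, huU, hu⟩ := SetLike.exists_of_lt h.1
  -- `t` is surjective on `U/T`, because `U = T[t u]`.
  have hsurj : ∀ y ∈ U, ∃ r : T, ∃ v ∈ U, y = algebraMap T S r + t • v := by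
    intro y hy
    obtain ⟨p, rfl⟩ := exists_aeval_eq_of_bot_covBy h (U.smul_mem huU t) (hinj u huU hu) hy
    refine ⟨p.coeff 0, u * aeval (t • u) p.divX, U.mul_mem huU ?_, ?_⟩
    · exact aeval_mem_of_mem (U.smul_mem huU t) p.divX
    · conv_lhs => rw [← divX_mul_X_add p]
      simp only [map_add, map_mul, aeval_X, aeval_C, Algebra.smul_def]
      ring
  have hclosed : ∀ x ∈ U, IsIntegral T x → x ∈ (⊥ : Subalgebra T S) := by
    intro x hx hxi
    by_contra hxb
    have hfg : (Subalgebra.toSubmodule U).FG := by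
      rw [← adjoin_eq_of_bot_covBy h hx hxb]
      exact hxi.fg_adjoin_singleton
    obtain ⟨r, hr, hrU⟩ := Submodule.exists_sub_one_mem_and_smul_le_of_fg_of_le_sup
      (I := Ideal.span {t}) (N := Subalgebra.toSubmodule (⊥ : Subalgebra T S))
      (N' := Subalgebra.toSubmodule U) (P := Subalgebra.toSubmodule U) hfg le_rfl (by
        intro y hy
        obtain ⟨r, v, hv, rfl⟩ := hsurj y hy
        refine Submodule.add_mem_sup (Algebra.mem_bot.2 ⟨r, rfl⟩) ?_
        exact Submodule.smul_mem_smul (Ideal.mem_span_singleton_self t) hv)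
    refine hu (hout u huU r (fun hrn => ?_) (hrU (Submodule.smul_mem_pointwise_smul u r _ huU)))
    have h1 : r - 1 ∈ 𝔫 := (Ideal.span_singleton_le_iff_mem 𝔫).2 ht hr
    exact (Ideal.ne_top_iff_one 𝔫).1 Ideal.IsPrime.ne_top' (by simpa using 𝔫.sub_mem hrn h1)
  -- The trace on `T` of the extended ideal `𝔫U` is `𝔫`.
  have hcontr : ∀ v ∈ U, t • v ∉ (⊥ : Subalgebra T S) → ∀ p : T[X], (∀ i, p.coeff i ∈ 𝔫) →
      ∀ w : T, algebraMap T S w = aeval (t • v) p → w ∈ 𝔫 := by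
    intro v hv htv p hp w hw
    set y := t • v with hy
    have hyU : y ∈ U := U.smul_mem hv t
    set z := aeval y p.divX with hz
    have hyz : y * z = algebraMap T S (w - p.coeff 0) := by
      rw [map_sub, hw]
      conv_rhs => rw [← divX_mul_X_add p]
      simp only [map_add, map_mul, aeval_X, aeval_C, coeff_add, coeff_C_zero, mul_coeff_zero,
        coeff_X_zero, mul_zero, zero_add]
      ring
    have hzU : z ∈ U := aeval_mem_of_mem hyU _
    have hvz : v * z ∈ (⊥ : Subalgebra T S) := by
      by_contra hcon
      refine hinj (v * z) (U.mul_mem hv hzU) hcon ?_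
      rw [← smul_mul_assoc, ← hy, hyz]
      exact Subalgebra.algebraMap_mem _ _
    obtain ⟨d, hd⟩ := Algebra.mem_bot.1 hvz
    have : t * d = w - p.coeff 0 := by
      apply hTS
      rw [map_mul, hd, ← hyz, hy, Algebra.smul_def, mul_assoc]
    have hw' : w = t * d + p.coeff 0 := by rw [this]; ring
    rw [hw']
    exact 𝔫.add_mem (𝔫.mul_mem_right _ ht) (hp 0)
  obtain ⟨r, v, hv, huv⟩ := hsurj u huU
  have hvb : v ∉ (⊥ : Subalgebra T S) := fun hvb =>
    hu (by rw [huv]; exact add_mem (Subalgebra.algebraMap_mem _ _) (Subalgebra.smul_mem _ hvb t))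
  have hyb := hinj v hv hvb
  set y := t • v with hy
  have hyU : y ∈ U := U.smul_mem hv t
  have hy2 : y ^ 2 ∉ (⊥ : Subalgebra T S) := by
    intro hmem
    obtain ⟨c, hc⟩ := Algebra.mem_bot.1 hmem
    refine hyb (hclosed y hyU ⟨X ^ 2 - C c, monic_X_pow_sub_C c two_ne_zero, ?_⟩)
    rw [← aeval_def]
    simp [hc]
  obtain ⟨p, hp⟩ := exists_aeval_eq_of_bot_covBy h (pow_mem hyU 2) hy2 hv
  have hcoeff : ∀ i, (X - C t * expand T 2 p).coeff i =
      (if 1 = i then 1 else 0) - t * (expand T 2 p).coeff i := by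
    intro i
    simp [coeff_X]
  have hC1 : (expand T 2 p).coeff 1 = 0 := by
    rw [coeff_expand two_pos]
    simp
  obtain ⟨s, hs, hsy⟩ := exists_smul_mem_bot_of_root 𝔫 (y := y)
    (fun a ha => hclosed _ (U.smul_mem hyU a) ha)
    (fun a ha c hc => hcontr v hv hyb (C a * X) (fun i => by
        rw [coeff_C_mul]
        exact 𝔫.mul_mem_right _ ha) c (by rw [← hc, map_mul, aeval_C, aeval_X, Algebra.smul_def]))
    _ (X - C t * expand T 2 p) le_rfl
    (by
      simp only [map_sub, map_mul, aeval_X, aeval_C, expand_aeval, hp]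
      rw [hy, Algebra.smul_def, sub_self])
    (by
      rw [hcoeff, hC1]
      simpa using (Ideal.ne_top_iff_one 𝔫).1 Ideal.IsPrime.ne_top')
    (fun i hi => by
      rw [hcoeff, if_neg (by omega), zero_sub]
      exact 𝔫.neg_mem (𝔫.mul_mem_right _ ht))
  exact hyb (hout y hyU s hs hsy)

/-- In a minimal extension `T ⊂ U`, a prime containing the conductor `(T : u₀)` of some element
`u₀ ∈ U ∖ T` is such that all elements outside it act injectively on `U/T`: the saturation of `T`
in `U` is not `U`, hence is `T`. -/
theorem mem_bot_of_smul_mem_bot {U : Subalgebra T S} (h : ⊥ ⋖ U) (𝔫 : Ideal T) [𝔫.IsPrime]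
    {u₀ : S} (hu₀ : u₀ ∈ U) (h₀ : ∀ a : T, a • u₀ ∈ (⊥ : Subalgebra T S) → a ∈ 𝔫) :
    ∀ u ∈ U, ∀ a ∉ 𝔫, a • u ∈ (⊥ : Subalgebra T S) → u ∈ (⊥ : Subalgebra T S) := by
  intro u hu a ha hau
  by_contra hub
  have hmem : u ∈ (⊥ : Subalgebra T S).saturationAt ⟨𝔫, ‹_›⟩ ⊓ U := ⟨⟨a, ha, hau⟩, hu⟩
  refine h.2 (c := (⊥ : Subalgebra T S).saturationAt ⟨𝔫, ‹_›⟩ ⊓ U) ?_ ?_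
  · exact bot_lt_iff_ne_bot.2 fun hbot => hub (hbot ▸ hmem)
  · refine lt_of_le_of_ne inf_le_right fun heq => ?_
    obtain ⟨⟨b, hb, hbu⟩, -⟩ := (heq.symm ▸ hu₀ : u₀ ∈ _ ⊓ U)
    exact hb (h₀ b hbu)

/-- The conductor `(T : u) = {a ∈ T | a u ∈ T}` of an element of an extension of `T`. -/
def elementConductor (T : Type*) {S : Type*} [CommRing T] [CommRing S] [Algebra T S] (u : S) :
    Ideal T where
  carrier := {a | a • u ∈ (⊥ : Subalgebra T S)}
  add_mem' ha hb := by
    simp only [Set.mem_ofPred_eq, add_smul] at *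
    exact add_mem ha hb
  zero_mem' := by simp
  smul_mem' c a ha := by
    simp only [Set.mem_ofPred_eq, smul_eq_mul, mul_smul] at *
    exact Subalgebra.smul_mem _ ha c

theorem mem_elementConductor {u : S} {a : T} :
    a ∈ elementConductor T u ↔ a • u ∈ (⊥ : Subalgebra T S) := Iff.rfl

/-- A minimal extension `T ⊂ U` has a crucial maximal ideal: every proper conductor `(T : u)`,
`u ∈ U`, has it as its radical. -/
theorem exists_crucial_of_bot_covBy {U : Subalgebra T S}
    (hTS : Function.Injective (algebraMap T S)) (h : ⊥ ⋖ U) :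
    ∃ 𝔪 : Ideal T, 𝔪.IsMaximal ∧
      (∀ u ∈ U, ∀ a ∈ 𝔪, ∃ n : ℕ, a ^ n • u ∈ (⊥ : Subalgebra T S)) ∧
      ∀ u ∈ U, ∀ a ∉ 𝔪, ∃ b j : T, j + b * a = 1 ∧ j • u ∈ (⊥ : Subalgebra T S) := by
  obtain ⟨u₀, hu₀, hb₀⟩ := SetLike.exists_of_lt h.1
  have hne : ∀ u ∉ (⊥ : Subalgebra T S), elementConductor T u ≠ ⊤ := fun u hu htop => hu (by
    have : (1 : T) ∈ elementConductor T u := htop ▸ Submodule.mem_top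
    simpa [mem_elementConductor] using this)
  obtain ⟨𝔪, h𝔪, hle⟩ := Ideal.exists_le_maximal _ (hne u₀ hb₀)
  have huniq : ∀ u ∈ U, u ∉ (⊥ : Subalgebra T S) → ∀ 𝔫 : Ideal T, 𝔫.IsPrime →
      elementConductor T u ≤ 𝔫 → 𝔫 = 𝔪 := by
    intro u hu _ 𝔫 _ hun
    have h1 := mem_bot_of_smul_mem_bot h 𝔪 hu₀ fun a ha => hle ha
    have h2 := mem_bot_of_smul_mem_bot h 𝔫 hu fun a ha => hun ha
    refine le_antisymm (fun t ht => ?_) fun t ht => ?_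
    · by_contra htm
      obtain ⟨v, hv, hvb, htv⟩ := exists_smul_mem_bot_of_mem hTS h 𝔫 h2 ht
      exact hvb (h1 v hv t htm htv)
    · by_contra htn
      obtain ⟨v, hv, hvb, htv⟩ := exists_smul_mem_bot_of_mem hTS h 𝔪 h1 ht
      exact hvb (h2 v hv t htn htv)
  refine ⟨𝔪, h𝔪, fun u hu a ha => ?_, fun u hu a ha => ?_⟩
  · by_cases hub : u ∈ (⊥ : Subalgebra T S)
    · exact ⟨0, by simpa using hub⟩
    have : a ∈ (elementConductor T u).radical := by
      rw [Ideal.radical_eq_sInf, Submodule.mem_sInf]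
      rintro 𝔫 ⟨hun, h𝔫⟩
      rwa [huniq u hu hub 𝔫 h𝔫 hun]
    exact this
  · by_cases hub : u ∈ (⊥ : Subalgebra T S)
    · exact ⟨0, 1, by simp, by simpa using hub⟩
    have htop : elementConductor T u ⊔ Ideal.span {a} = ⊤ := by
      by_contra hne'
      obtain ⟨𝔫, h𝔫, hn⟩ := Ideal.exists_le_maximal _ hne'
      have := huniq u hu hub 𝔫 h𝔫.isPrime (le_sup_left.trans hn)
      subst this
      exact ha (hn (Ideal.mem_sup_right (Ideal.mem_span_singleton_self a)))
    have h1 : (1 : T) ∈ elementConductor T u ⊔ Ideal.span {a} := htop ▸ Submodule.mem_top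
    obtain ⟨j, hj, k, hk, hjk⟩ := Submodule.mem_sup.1 h1
    obtain ⟨b, rfl⟩ := Ideal.mem_span_singleton'.1 hk
    exact ⟨b, j, hjk, hj⟩

end Minimal

/-! ### Minimal steps and saturation -/

section Crucial

variable {R S : Type*} [CommRing R] [CommRing S] [Algebra R S]

theorem exists_crucial_ideal {T U : Subalgebra R S} (h : T ⋖ U) :
    ∃ 𝔪 : Ideal T, 𝔪.IsMaximal ∧
      (∀ u ∈ U, ∀ a ∈ 𝔪, ∃ n : ℕ, (a : S) ^ n * u ∈ T) ∧
      ∀ u ∈ U, ∀ a ∉ 𝔪, ∃ b j : T, j + b * a = 1 ∧ (j : S) * u ∈ T := by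
  have hbot : ∀ x : S, x ∈ (⊥ : Subalgebra T S) ↔ x ∈ T := by
    intro x
    rw [Algebra.mem_bot]
    exact ⟨fun ⟨y, hy⟩ => hy ▸ y.2, fun hx => ⟨⟨x, hx⟩, rfl⟩⟩
  let U' : Subalgebra T S := { U with algebraMap_mem' := fun t => h.le t.2 }
  have hU' : ∀ x : S, x ∈ U' ↔ x ∈ U := fun _ => Iff.rfl
  have hcov : (⊥ : Subalgebra T S) ⋖ U' := by
    refine ⟨lt_of_le_of_ne bot_le fun heq => h.lt.ne ?_, fun W h1 h2 => ?_⟩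
    · ext x
      rw [← hbot, heq, hU']
    · refine h.2 (c := W.restrictScalars R) ?_ ?_
      · refine SetLike.lt_iff_le_and_exists.2 ⟨fun x hx => h1.le ((hbot x).2 hx), ?_⟩
        obtain ⟨x, hx, hx'⟩ := SetLike.exists_of_lt h1
        exact ⟨x, hx, fun h => hx' ((hbot x).2 h)⟩
      · refine SetLike.lt_iff_le_and_exists.2 ⟨fun x hx => h2.le hx, ?_⟩
        obtain ⟨x, hx, hx'⟩ := SetLike.exists_of_lt h2
        exact ⟨x, hx, hx'⟩
  obtain ⟨𝔪, h𝔪, h1, h2⟩ := exists_crucial_of_bot_covBy Subtype.val_injective hcov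
  refine ⟨𝔪, h𝔪, fun u hu a ha => ?_, fun u hu a ha => ?_⟩
  · obtain ⟨n, hn⟩ := h1 u hu a ha
    exact ⟨n, (hbot _).1 hn⟩
  · obtain ⟨b, j, hbj, hj⟩ := h2 u hu a ha
    exact ⟨b, j, hbj, (hbot _).1 hj⟩

/-- `P` is the prime of `R` below the crucial maximal ideal of the minimal extension `T ⊂ U`,
expressed through saturations: the localizations of `T` and `U` at a prime `Q` are different if and
only if `P ≤ Q`. -/
structure IsCrucialPrime (P : PrimeSpectrum R) (T U : Subalgebra R S) : Prop where
  le_saturationAt : ∀ Q, ¬ P ≤ Q → U ≤ T.saturationAt Q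
  saturationAt_inf_le : ∀ Q, P ≤ Q → T.saturationAt Q ⊓ U ≤ T

theorem exists_isCrucialPrime {T U : Subalgebra R S} (h : T ⋖ U) :
    ∃ P : PrimeSpectrum R, IsCrucialPrime P T U ∧
      (Algebra.IsIntegral R S → P.asIdeal.IsMaximal) := by
  obtain ⟨𝔪, h𝔪, h1, h2⟩ := exists_crucial_ideal h
  refine ⟨⟨𝔪.comap (algebraMap R T), inferInstance⟩, ⟨fun Q hQ u hu => ?_, ?_⟩, fun hint => ?_⟩
  · obtain ⟨a, ha, haQ⟩ := Set.not_subset.1 hQ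
    obtain ⟨n, hn⟩ := h1 u hu _ ha
    refine ⟨a ^ n, Q.asIdeal.primeCompl.pow_mem haQ n, ?_⟩
    rw [Algebra.smul_def, map_pow]
    exact hn
  · rintro Q hQ u ⟨⟨a, ha, hau⟩, hu⟩
    obtain ⟨b, j, hbj, hj⟩ := h2 u hu (algebraMap R T a) fun h => ha (hQ h)
    have : u = j * u + b * (a • u) := by
      have h1 : (j : S) + b * algebraMap R S a = 1 := congrArg Subtype.val hbj
      rw [Algebra.smul_def, ← mul_assoc, ← add_mul, h1, one_mul]
    rw [this]
    exact T.add_mem hj (T.mul_mem b.2 hau)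
  · have : Algebra.IsIntegral R T := ⟨fun x =>
      (isIntegral_algHom_iff T.val Subtype.val_injective).1 (hint.isIntegral (x : S))⟩
    exact Ideal.isMaximal_comap_of_isIntegral_of_isMaximal 𝔪

/-- If `T` is saturated at a prime `Q` and `T ⊂ U` is minimal, then `U` is saturated at `Q`.
For `a ∉ Q` and `v` with `a v ∈ U`, saturation of `T` forces `a` outside the crucial maximal ideal
of `T ⊂ U`, so that `1 = j + b a` with `j (a v) ∈ T`; then `j v ∈ T` and `v = j v + b a v ∈ U`. -/
theorem saturationAt_eq_of_covBy {Q : PrimeSpectrum R} {T U : Subalgebra R S} (h : T ⋖ U)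
    (hT : T.saturationAt Q = T) : U.saturationAt Q = U := by
  obtain ⟨𝔪, h𝔪, h1, h2⟩ := exists_crucial_ideal h
  refine le_antisymm ?_ (Subalgebra.le_saturationAt _ _)
  rintro v ⟨a, ha, hav⟩
  have ha𝔪 : algebraMap R T a ∉ 𝔪 := by
    intro ham
    obtain ⟨u, hu, huT⟩ := SetLike.exists_of_lt h.lt
    obtain ⟨n, hn⟩ := h1 u hu _ ham
    refine huT (hT ▸ ⟨a ^ n, Q.asIdeal.primeCompl.pow_mem ha n, ?_⟩)
    rw [Algebra.smul_def, map_pow]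
    exact hn
  obtain ⟨b, j, hbj, hj⟩ := h2 _ hav _ ha𝔪
  have hjv : (j : S) * v ∈ T := by
    exact hT.le ⟨a, ha, by rwa [← mul_smul_comm]⟩
  have : v = j * v + b * (a • v) := by
    have h1 : (j : S) + b * algebraMap R S a = 1 := congrArg Subtype.val hbj
    rw [Algebra.smul_def, ← mul_assoc, ← add_mul, h1, one_mul]
  rw [this]
  exact U.add_mem (h.le hjv) (U.mul_mem (h.le b.2) hav)

theorem saturationAt_eq_of_le [WellFoundedLT (Subalgebra R S)] [WellFoundedGT (Subalgebra R S)]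
    {Q : PrimeSpectrum R} {T : Subalgebra R S}
    (hT : (⊥ : Subalgebra R S).saturationAt Q ≤ T) : T.saturationAt Q = T := by
  obtain ⟨n, hn⟩ := exists_covBy_stepChain hT
  clear hT
  induction hn with
  | refl => exact Subalgebra.saturationAt_saturationAt _ _
  | snoc _ h ih => exact saturationAt_eq_of_covBy h ih

theorem IsCrucialPrime.saturationAt_eq {P Q : PrimeSpectrum R} {T U : Subalgebra R S}
    (hP : IsCrucialPrime P T U) (h : T ⋖ U) (hPQ : ¬ P ≤ Q) :
    T.saturationAt Q = U.saturationAt Q := by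
  refine le_antisymm (Subalgebra.saturationAt_mono Q h.le) ?_
  rw [← Subalgebra.saturationAt_saturationAt Q T]
  exact Subalgebra.saturationAt_mono Q (hP.le_saturationAt Q hPQ)

theorem IsCrucialPrime.saturationAt_covBy [WellFoundedLT (Subalgebra R S)]
    [WellFoundedGT (Subalgebra R S)] {P Q : PrimeSpectrum R} {T U : Subalgebra R S}
    (hP : IsCrucialPrime P T U) (h : T ⋖ U) (hPQ : P ≤ Q) :
    T.saturationAt Q ⋖ U.saturationAt Q := by
  refine ⟨lt_of_le_of_ne (Subalgebra.saturationAt_mono Q h.le) fun heq => ?_, ?_⟩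
  · refine h.lt.not_ge (le_trans (le_inf ?_ le_rfl) (hP.saturationAt_inf_le Q hPQ))
    rw [heq]
    exact Subalgebra.le_saturationAt _ _
  · intro W h1 h2
    have hW : W.saturationAt Q = W :=
      saturationAt_eq_of_le ((Subalgebra.saturationAt_mono Q bot_le).trans h1.le)
    have hWU : (W ⊓ U).saturationAt Q = W := by
      rw [Subalgebra.saturationAt_inf, hW, inf_eq_left.2 h2.le]
    rcases h.eq_or_eq (le_inf ((Subalgebra.le_saturationAt Q T).trans h1.le) h.le)
      inf_le_right with heq | heq
    · rw [heq] at hWU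
      exact h1.ne hWU
    · rw [heq] at hWU
      exact h2.ne hWU.symm

open scoped Classical in
/-- A saturated chain from `T` to `U` has a multiset of crucial primes, and its image under
saturation at `Q` is a saturated chain, with as many steps as there are crucial primes `P ≤ Q`. -/
theorem StepChain.exists_crucialPrimes [WellFoundedLT (Subalgebra R S)]
    [WellFoundedGT (Subalgebra R S)] {T U : Subalgebra R S} {n : ℕ}
    (h : StepChain (· ⋖ ·) T U n) :
    ∃ A : Multiset (PrimeSpectrum R), A.card = n ∧
      (Algebra.IsIntegral R S → ∀ P ∈ A, P.asIdeal.IsMaximal) ∧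
      ∀ Q, StepChain (· ⋖ ·) (T.saturationAt Q) (U.saturationAt Q) (A.countP (· ≤ Q)) := by
  induction h with
  | refl => exact ⟨0, rfl, by simp, fun Q => .refl _⟩
  | snoc _ h₂ ih =>
    obtain ⟨A, hA, hmax, hc⟩ := ih
    obtain ⟨P, hP, hPmax⟩ := exists_isCrucialPrime h₂
    refine ⟨P ::ₘ A, by simp [hA], fun hint => ?_, fun Q => ?_⟩
    · simpa using ⟨hPmax hint, hmax hint⟩
    · by_cases hPQ : P ≤ Q
      · rw [Multiset.countP_cons_of_pos (p := (· ≤ Q)) _ hPQ]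
        exact (hc Q).snoc (hP.saturationAt_covBy h₂ hPQ)
      · rw [Multiset.countP_cons_of_neg (p := (· ≤ Q)) _ hPQ, ← hP.saturationAt_eq h₂ hPQ]
        exact hc Q

/-- For an integral extension, a subalgebra that is saturated at one maximal ideal is locally the
whole ring at any other one: all crucial primes above it are equal to that first maximal ideal. -/
theorem saturationAt_saturationAt_eq_top [WellFoundedLT (Subalgebra R S)]
    [WellFoundedGT (Subalgebra R S)] (hint : Algebra.IsIntegral R S) {M N : PrimeSpectrum R}
    (hM : M.asIdeal.IsMaximal) (hMN : M ≠ N) :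
    ((⊥ : Subalgebra R S).saturationAt N).saturationAt M = ⊤ := by
  set T := (⊥ : Subalgebra R S).saturationAt N with hTdef
  have hT : T.saturationAt N = T := Subalgebra.saturationAt_saturationAt _ _
  clear_value T
  obtain ⟨n, hn⟩ := exists_covBy_stepChain (le_top (a := T))
  suffices ∀ U n, StepChain (· ⋖ ·) T U n →
      U.saturationAt N = U ∧ U.saturationAt M = T.saturationAt M by
    rw [← (this _ _ hn).2, Subalgebra.saturationAt_top]
  intro U n h
  induction h with
  | refl => exact ⟨hT, rfl⟩
  | snoc _ h₂ ih =>
    refine ⟨saturationAt_eq_of_covBy h₂ ih.1, ?_⟩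
    obtain ⟨P, hP, hPmax⟩ := exists_isCrucialPrime h₂
    rw [← ih.2]
    refine (hP.saturationAt_eq h₂ fun hPM => ?_).symm
    have hPM' : P = M := PrimeSpectrum.ext ((hPmax hint).eq_of_le hM.ne_top hPM)
    subst hPM'
    have hPN : P ≤ N := by
      by_contra hPN
      exact h₂.lt.not_ge (ih.1 ▸ hP.le_saturationAt N hPN)
    exact hMN (PrimeSpectrum.ext (hM.eq_of_le N.isPrime.ne_top hPN))

theorem notMem_extSupp_iff {P : PrimeSpectrum R} :
    P ∉ extSupp R S ↔ (⊥ : Subalgebra R S).saturationAt P = ⊤ := by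
  rw [extSupp, Module.notMem_support_iff', eq_top_iff]
  constructor
  · rintro h s -
    obtain ⟨r, hr, hrs⟩ := h (Submodule.Quotient.mk s)
    rw [← Submodule.Quotient.mk_smul, Submodule.Quotient.mk_eq_zero] at hrs
    exact ⟨r, hr, Algebra.mem_bot.2 hrs⟩
  · rintro h m
    obtain ⟨s, rfl⟩ := Submodule.Quotient.mk_surjective _ m
    obtain ⟨r, hr, hrs⟩ := h (Algebra.mem_top (x := s))
    refine ⟨r, hr, ?_⟩
    rw [← Submodule.Quotient.mk_smul, Submodule.Quotient.mk_eq_zero]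
    exact Algebra.mem_bot.1 hrs

end Crucial

/-! ### Subalgebras of a localization -/

section Localization

variable {R S : Type*} [CommRing R] [CommRing S] [Algebra R S] (P : PrimeSpectrum R)

/-- The preimage in `S` of an `R_P`-subalgebra of `S_P`. -/
noncomputable def locPreimage (W : Subalgebra (BaseLoc R P) (ExtLoc R S P)) : Subalgebra R S :=
  (W.restrictScalars R).comap (IsScalarTower.toAlgHom R S (ExtLoc R S P))

theorem mem_locPreimage {W : Subalgebra (BaseLoc R P) (ExtLoc R S P)} {s : S} :
    s ∈ locPreimage P W ↔ algebraMap S (ExtLoc R S P) s ∈ W := Iff.rfl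

variable {P}

theorem smul_mem_iff_of_notMem {W : Subalgebra (BaseLoc R P) (ExtLoc R S P)} {a : R}
    (ha : a ∉ P.asIdeal) {x : ExtLoc R S P} : a • x ∈ W ↔ x ∈ W := by
  refine ⟨fun h => ?_, fun h => (W.restrictScalars R).smul_mem h a⟩
  obtain ⟨u, hu⟩ := IsLocalization.map_units (BaseLoc R P) (⟨a, ha⟩ : P.asIdeal.primeCompl)
  have h2 := W.smul_mem h (↑u⁻¹ : BaseLoc R P)
  rwa [← algebraMap_smul (BaseLoc R P) a x, ← hu, smul_smul, Units.inv_mul, one_smul] at h2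

theorem exists_smul_eq_algebraMap (x : ExtLoc R S P) :
    ∃ a ∉ P.asIdeal, ∃ s : S, a • x = algebraMap S (ExtLoc R S P) s := by
  obtain ⟨⟨s, _, a, ha, rfl⟩, h⟩ :=
    IsLocalization.surj (Algebra.algebraMapSubmonoid S P.asIdeal.primeCompl) x
  refine ⟨a, ha, s, ?_⟩
  rw [← h, Algebra.smul_def, mul_comm, IsScalarTower.algebraMap_apply R S]

theorem algebraMap_smul_extLoc (a : R) (s : S) :
    algebraMap S (ExtLoc R S P) (a • s) = a • algebraMap S (ExtLoc R S P) s :=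
  map_smul (IsScalarTower.toAlgHom R S (ExtLoc R S P)) a s

theorem locPreimage_le_iff {W W' : Subalgebra (BaseLoc R P) (ExtLoc R S P)} :
    locPreimage P W ≤ locPreimage P W' ↔ W ≤ W' := by
  refine ⟨fun h x hx => ?_, fun h s hs => h hs⟩
  obtain ⟨a, ha, s, hs⟩ := exists_smul_eq_algebraMap x
  rw [← smul_mem_iff_of_notMem ha, hs] at hx ⊢
  exact h hx

theorem saturationAt_locPreimage (W : Subalgebra (BaseLoc R P) (ExtLoc R S P)) :
    (locPreimage P W).saturationAt P = locPreimage P W := by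
  refine le_antisymm ?_ (Subalgebra.le_saturationAt _ _)
  rintro s ⟨a, ha, hs⟩
  rw [mem_locPreimage, algebraMap_smul_extLoc] at hs
  exact (smul_mem_iff_of_notMem ha).1 hs

theorem exists_locPreimage_eq (T : Subalgebra R S) (hT : T.saturationAt P = T) :
    ∃ W : Subalgebra (BaseLoc R P) (ExtLoc R S P), locPreimage P W = T := by
  refine ⟨{ carrier := {x | ∃ a ∉ P.asIdeal, ∃ t ∈ T, a • x = algebraMap S (ExtLoc R S P) t}
            mul_mem' := ?_
            add_mem' := ?_
            algebraMap_mem' := ?_ }, ?_⟩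
  · rintro x y ⟨a, ha, s, hs, hx⟩ ⟨b, hb, t, ht, hy⟩
    refine ⟨a * b, P.asIdeal.primeCompl.mul_mem ha hb, s * t, T.mul_mem hs ht, ?_⟩
    rw [← smul_mul_smul_comm, hx, hy, map_mul]
  · rintro x y ⟨a, ha, s, hs, hx⟩ ⟨b, hb, t, ht, hy⟩
    refine ⟨a * b, P.asIdeal.primeCompl.mul_mem ha hb, b • s + a • t,
      T.add_mem (T.smul_mem hs b) (T.smul_mem ht a), ?_⟩
    rw [map_add, algebraMap_smul_extLoc, algebraMap_smul_extLoc, ← hx, ← hy, smul_add, smul_smul,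
      smul_smul, mul_comm b a]
  · intro r
    obtain ⟨⟨c, a⟩, h⟩ := IsLocalization.surj P.asIdeal.primeCompl r
    refine ⟨a, a.2, algebraMap R S c, T.algebraMap_mem c, ?_⟩
    rw [← IsScalarTower.algebraMap_apply, IsScalarTower.algebraMap_apply R (BaseLoc R P), ← h,
      map_mul, ← IsScalarTower.algebraMap_apply, Algebra.smul_def, mul_comm]
  · ext s
    constructor
    · rintro ⟨a, ha, t, ht, h⟩
      change a • algebraMap S (ExtLoc R S P) s = _ at h
      rw [← algebraMap_smul_extLoc] at h
      obtain ⟨⟨_, b, hb, rfl⟩, hbt⟩ := (IsLocalization.eq_iff_exists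
        (Algebra.algebraMapSubmonoid S P.asIdeal.primeCompl) (ExtLoc R S P)).1 h
      rw [← hT]
      refine ⟨b * a, P.asIdeal.primeCompl.mul_mem hb ha, ?_⟩
      rw [mul_smul, Algebra.smul_def b, hbt]
      exact T.mul_mem (T.algebraMap_mem b) ht
    · intro hs
      exact ⟨1, P.asIdeal.primeCompl.one_mem, s, hs, one_smul _ _⟩

/-- `[R_P, S_P]` is isomorphic to the interval of `[R, S]` above the saturation of `R` at `P`, since
all members of this interval are saturated. -/
theorem exists_orderIso_Ici [WellFoundedLT (Subalgebra R S)] [WellFoundedGT (Subalgebra R S)]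
    (P : PrimeSpectrum R) : Nonempty (Subalgebra (BaseLoc R P) (ExtLoc R S P) ≃o
      Set.Ici ((⊥ : Subalgebra R S).saturationAt P)) := by
  let f : Subalgebra (BaseLoc R P) (ExtLoc R S P) → Set.Ici ((⊥ : Subalgebra R S).saturationAt P) :=
    fun W => ⟨locPreimage P W, by
      rw [Set.mem_Ici, ← saturationAt_locPreimage W]
      exact Subalgebra.saturationAt_mono P bot_le⟩
  have hf : Function.Bijective f := by
    refine ⟨fun W W' h => ?_, fun T => ?_⟩
    · have h := congrArg Subtype.val h
      exact le_antisymm (locPreimage_le_iff.1 h.le) (locPreimage_le_iff.1 h.ge)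
    · obtain ⟨W, hW⟩ := exists_locPreimage_eq T.1 (saturationAt_eq_of_le T.2)
      exact ⟨W, Subtype.ext hW⟩
  exact ⟨⟨Equiv.ofBijective f hf, locPreimage_le_iff⟩⟩

theorem isCatenarian_localization_iff (hFCP : HasFCP R S) (P : PrimeSpectrum R) :
    IsCatenarian (BaseLoc R P) (ExtLoc R S P) ↔
      ChainsEqui ((⊥ : Subalgebra R S).saturationAt P) ⊤ := by
  have := wellFoundedLT_of_finite_chains hFCP
  have := wellFoundedGT_of_finite_chains hFCP
  obtain ⟨e⟩ := exists_orderIso_Ici (S := S) P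
  have hF : HasFCP (BaseLoc R P) (ExtLoc R S P) := by
    intro c hc
    refine Set.Finite.of_finite_image (f := fun W => (e W : Subalgebra R S)) (hFCP _ ?_)
      (Subtype.val_injective.comp e.injective).injOn
    rintro _ ⟨x, hx, rfl⟩ _ ⟨y, hy, rfl⟩ -
    exact (hc.total hx hy).imp (fun h => e.monotone h) (fun h => e.monotone h)
  have hcov : ∀ n, StepChain (· ⋖ ·) (⊥ : Subalgebra (BaseLoc R P) (ExtLoc R S P)) ⊤ n ↔
      StepChain (· ⋖ ·) ((⊥ : Subalgebra R S).saturationAt P) ⊤ n := by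
    intro n
    refine stepChain_iff_of_orderIso_Ici e (fun _ _ h => h.le) fun x y => ?_
    rw [← apply_covBy_apply_iff e]
    exact (Set.OrdConnected.apply_covBy_apply_iff
      (OrderEmbedding.subtype (· ∈ Set.Ici ((⊥ : Subalgebra R S).saturationAt P)))
      (by
        rw [OrderEmbedding.coe_subtype, Subtype.range_coe_subtype]
        exact Set.ordConnected_Ici)).symm
  rw [isCatenarian_iff, and_iff_right hF]
  simp only [ChainsEqui, hcov]

theorem extLength_localization (hFCP : HasFCP R S) (P : PrimeSpectrum R) :
    extLength (BaseLoc R P) (ExtLoc R S P) =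
      chainLength ((⊥ : Subalgebra R S).saturationAt P) ⊤ := by
  have := wellFoundedLT_of_finite_chains hFCP
  have := wellFoundedGT_of_finite_chains hFCP
  obtain ⟨e⟩ := exists_orderIso_Ici (S := S) P
  rw [extLength_eq_chainLength]
  have h : ∀ n, StepChain (· < ·) (⊥ : Subalgebra (BaseLoc R P) (ExtLoc R S P)) ⊤ n ↔
      StepChain (· < ·) ((⊥ : Subalgebra R S).saturationAt P) ⊤ n := fun n =>
    stepChain_iff_of_orderIso_Ici e (fun _ _ h => h.le) fun x y => by
      rw [Subtype.coe_lt_coe, e.lt_iff_lt]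
  exact (Equiv.subtypeEquivRight h).iSup_congr fun _ => rfl

end Localization

/-! ### Catenarity and lengths -/

section Main

variable {R S : Type*} [CommRing R] [CommRing S] [Algebra R S]

/-- If all localizations satisfy the Jordan–Dedekind condition, two saturated chains from `R` to `S`
have the same number of crucial primes below each prime, hence the same crucial primes. -/
theorem chainsEqui_of_saturationAt [WellFoundedLT (Subalgebra R S)]
    [WellFoundedGT (Subalgebra R S)]
    (h : ∀ P, ChainsEqui ((⊥ : Subalgebra R S).saturationAt P) ⊤) :
    ChainsEqui (⊥ : Subalgebra R S) ⊤ := by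
  classical
  intro m n hm hn
  obtain ⟨A, hA, -, hA'⟩ := hm.exists_crucialPrimes
  obtain ⟨B, hB, -, hB'⟩ := hn.exists_crucialPrimes
  have hAB : A = B := Multiset.eq_of_countP_le_eq _ A B rfl fun P => by
    have h1 := hA' P
    have h2 := hB' P
    rw [Subalgebra.saturationAt_top] at h1 h2
    convert h P _ _ h1 h2
  rw [← hA, ← hB, hAB]

theorem ChainsEqui.saturationAt [WellFoundedLT (Subalgebra R S)] [WellFoundedGT (Subalgebra R S)]
    (h : ∀ M ∈ extMSupp R S, ChainsEqui ((⊥ : Subalgebra R S).saturationAt M) ⊤)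
    (P : PrimeSpectrum R) : ChainsEqui ((⊥ : Subalgebra R S).saturationAt P) ⊤ := by
  by_cases hP : P ∈ extSupp R S
  · obtain ⟨M, hM, hPM⟩ := P.asIdeal.exists_le_maximal P.isPrime.ne_top
    have hPM' : P ≤ ⟨M, hM.isPrime⟩ := hPM
    exact (h ⟨M, hM.isPrime⟩ ⟨Module.mem_support_mono hPM' hP, hM⟩).of_le
      (Subalgebra.saturationAt_anti hPM' _)
  · rw [notMem_extSupp_iff.1 hP]
    exact ChainsEqui.self _

theorem isCatenarian_tfae (hFCP : HasFCP R S) : List.TFAE [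
    IsCatenarian R S,
    ∀ M ∈ extMSupp R S, IsCatenarian (BaseLoc R M) (ExtLoc R S M),
    ∀ P ∈ extSupp R S, IsCatenarian (BaseLoc R P) (ExtLoc R S P)] := by
  have := wellFoundedLT_of_finite_chains hFCP
  have := wellFoundedGT_of_finite_chains hFCP
  simp only [isCatenarian_localization_iff hFCP]
  rw [isCatenarian_iff, and_iff_right hFCP]
  tfae_have 1 → 3 := fun h P _ => h.of_le bot_le
  tfae_have 3 → 2 := fun h M hM => h M hM.1
  tfae_have 2 → 1 := fun h => chainsEqui_of_saturationAt (ChainsEqui.saturationAt h)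
  tfae_finish

/-- For distinct maximal ideals `Mᵢ` of `R`, strict chains from the saturations of `R` at `Mᵢ` to
`S` can be stacked: the chain at `M` is intersected with the intersection `E` of the other
saturations, and loses no step because the saturation of `E` at `M` is `S`. -/
theorem sum_chainLength_le [WellFoundedLT (Subalgebra R S)] [WellFoundedGT (Subalgebra R S)]
    (hint : Algebra.IsIntegral R S) (F : Finset (PrimeSpectrum R))
    (hF : ∀ M ∈ F, M.asIdeal.IsMaximal) :
    ∑ M ∈ F, chainLength ((⊥ : Subalgebra R S).saturationAt M) ⊤ ≤
      chainLength (F.inf fun M => (⊥ : Subalgebra R S).saturationAt M) ⊤ := by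
  classical
  induction F using Finset.induction_on with
  | empty => simp
  | insert M F hMF ih =>
    have hM : M.asIdeal.IsMaximal := hF M (Finset.mem_insert_self _ _)
    rw [Finset.sum_insert hMF, Finset.inf_insert]
    set E := F.inf fun M => (⊥ : Subalgebra R S).saturationAt M with hE
    have hEM : E.saturationAt M = ⊤ := by
      have key : ∀ G ⊆ F, (G.inf fun M =>
          (⊥ : Subalgebra R S).saturationAt M).saturationAt M = ⊤ := by
        intro G
        induction G using Finset.induction_on with
        | empty => exact fun _ => Subalgebra.saturationAt_top M
        | insert N G hN ihG =>
          intro hG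
          have hNM : M ≠ N := fun h => hMF (h ▸ hG (Finset.mem_insert_self _ _))
          rw [Finset.inf_insert, Subalgebra.saturationAt_inf,
            saturationAt_saturationAt_eq_top hint hM hNM,
            ihG ((Finset.subset_insert _ _).trans hG), inf_top_eq]
      exact key F subset_rfl
    refine le_trans (add_le_add ?_ (ih fun N hN => hF N (Finset.mem_insert_of_mem hN)))
      (chainLength_add_le (inf_le_right (a := (⊥ : Subalgebra R S).saturationAt M)) le_top)
    have hrec : ∀ W : Set.Ici ((⊥ : Subalgebra R S).saturationAt M),
        (W.1 ⊓ E).saturationAt M = W := by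
      intro W
      rw [Subalgebra.saturationAt_inf, hEM, inf_top_eq, saturationAt_eq_of_le W.2]
    have := chainLength_le_of_strictMono (a := (⊥ : Subalgebra R S).saturationAt M) (b := ⊤)
      (fun W => W.1 ⊓ E)
      (Monotone.strictMono_of_injective (fun W W' h => inf_le_inf_right E h) fun W W' h => by
        apply Subtype.ext
        rw [← hrec W, ← hrec W']
        exact congrArg _ h) le_top
    simpa only [top_inf_eq] using this

theorem extLength_eq_sum (hFCP : HasFCP R S) (hint : Algebra.IsIntegral R S) :
    ∃ hfin : (extMSupp R S).Finite,
      extLength R S = ∑ M ∈ hfin.toFinset, extLength (BaseLoc R M) (ExtLoc R S M) := by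
  classical
  have := wellFoundedLT_of_finite_chains hFCP
  have := wellFoundedGT_of_finite_chains hFCP
  simp only [extLength_localization hFCP, extLength_eq_chainLength R S]
  -- Crucial primes are maximal, and so those below a maximal ideal `M` are equal to `M`.
  have hchain : ∀ n, StepChain (· ⋖ ·) (⊥ : Subalgebra R S) ⊤ n →
      ∃ A : Multiset (PrimeSpectrum R), A.card = n ∧ (∀ P ∈ A, P.asIdeal.IsMaximal) ∧
        ∀ M : PrimeSpectrum R, M.asIdeal.IsMaximal →
          StepChain (· < ·) ((⊥ : Subalgebra R S).saturationAt M) ⊤ (A.count M) := by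
    intro n hn
    obtain ⟨A, hA, hmax, hc⟩ := hn.exists_crucialPrimes
    refine ⟨A, hA, hmax hint, fun M hM => ?_⟩
    have h := (hc M).strict
    rw [Subalgebra.saturationAt_top] at h
    convert h using 1
    refine Multiset.countP_congr rfl fun P hP => propext ?_
    exact ⟨fun h => h.ge,
      fun h => (PrimeSpectrum.ext ((hmax hint P hP).eq_of_le hM.ne_top h)).symm⟩
  have hmem : ∀ n, StepChain (· ⋖ ·) (⊥ : Subalgebra R S) ⊤ n →
      ∃ A : Multiset (PrimeSpectrum R), A.card = n ∧
        (∀ P, P ∈ extMSupp R S ↔ P ∈ A) ∧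
        ∀ M : PrimeSpectrum R, M.asIdeal.IsMaximal →
          StepChain (· < ·) ((⊥ : Subalgebra R S).saturationAt M) ⊤ (A.count M) := by
    intro n hn
    obtain ⟨A, hA, hmax, hc⟩ := hchain n hn
    refine ⟨A, hA, fun P => ⟨fun hP => ?_, fun hP => ⟨?_, hmax P hP⟩⟩, hc⟩
    · by_contra hPA
      have h := hc P hP.2
      rw [Multiset.count_eq_zero_of_notMem hPA] at h
      refine notMem_extSupp_iff.2 ?_ hP.1
      generalize (⊥ : Subalgebra R S).saturationAt P = T at h
      cases h
      rfl
    · by_contra hPS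
      have h := hc P (hmax P hP)
      rw [notMem_extSupp_iff.1 hPS] at h
      exact (Multiset.count_pos.2 hP).ne' h.eq_zero_of_self
  have hfin : (extMSupp R S).Finite := by
    obtain ⟨n, hn⟩ := exists_covBy_stepChain (bot_le (a := (⊤ : Subalgebra R S)))
    obtain ⟨A, -, hA, -⟩ := hmem n hn
    exact A.toFinset.finite_toSet.subset fun P hP => by simpa using (hA P).1 hP
  refine ⟨hfin, le_antisymm (iSup_le fun n => ?_) ?_⟩
  · obtain ⟨m, hnm, hm⟩ := n.2.exists_refinement
    obtain ⟨A, hA, hAS, hc⟩ := hmem m hm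
    have hsum : ∑ M ∈ hfin.toFinset, A.count M = m := by
      rw [← hA]
      exact Multiset.sum_count_eq_card fun P hP => by simpa using (hAS P).2 hP
    calc (n.1 : ℕ∞) ≤ m := by exact_mod_cast hnm
      _ = ∑ M ∈ hfin.toFinset, (A.count M : ℕ∞) := by rw [← hsum]; push_cast; rfl
      _ ≤ _ := Finset.sum_le_sum fun M hM =>
        (hc M (by simpa using hM : M ∈ extMSupp R S).2).le_chainLength
  · refine (sum_chainLength_le hint hfin.toFinset fun M hM => ?_).trans ?_
    · exact (by simpa using hM : M ∈ extMSupp R S).2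
    · exact le_trans le_add_self (chainLength_add_le bot_le le_top)

end Main

theorem proposition3p3 (R : Type*) (S : Type*) [CommRing R] [CommRing S] [Algebra R S]
    (hinj : Function.Injective (algebraMap R S)) (hFCP : HasFCP R S) :
    (Algebra.IsIntegral R S →
      (IsCatenarian R S ↔ ∀ M ∈ extMSupp R S, IsCatenarian (BaseLoc R M) (ExtLoc R S M))) ∧
    List.TFAE [
      IsCatenarian R S,
      ∀ M ∈ extMSupp R S, IsCatenarian (BaseLoc R M) (ExtLoc R S M),
      ∀ P ∈ extSupp R S, IsCatenarian (BaseLoc R P) (ExtLoc R S P)] ∧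
    (Algebra.IsIntegral R S →
      ∃ hfin : (extMSupp R S).Finite,
        extLength R S = ∑ M ∈ hfin.toFinset, extLength (BaseLoc R M) (ExtLoc R S M)) :=
  ⟨fun _ => (isCatenarian_tfae hFCP).out 0 1, isCatenarian_tfae hFCP, extLength_eq_sum hFCP⟩
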